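/- Let $\mathbb{H}^d$ denote $d$-dimensional hyperbolic space of constant curvature $-1$, with Riemannian distance $\mathrm{dist}$, exponential maps $\exp_x$ and their inverses $\log_x$. A function $f\colon\mathbb{H}^d\to\mathbb{R}$ is g-convex if $f(\gamma(t))\le(1-t)f(\gamma(0))+tf(\gamma(1))$ for every geodesic $\gamma\colon[0,1]\to\mathbb{H}^d$ and every $t\in[0,1]$. A vector $g\in T_x\mathbb{H}^d$ is a subgradient of $f$ at $x$ if $f(y)\ge f(x)+\langle g,\log_x(y)\rangle$ for all $y\in\mathbb{H}^d$. A deterministic first-order algorithm $\mathcal{A}$ on $\mathbb{H}^d$ is a sequence of functions $\mathcal{A}_k\colon(\mathbb{R}\times T\mathbb{H}^d)^k\to\mathbb{H}^d$, $k\ge 0$. An oracle for $f$ is a choice of a subgradient $g(x)$ of $f$ at every point $x$; running $\mathcal{A}$ on $f$ with this oracle produces the queries $x_k=\mathcal{A}_k\big((f(x_\ell),(x_\ell,g(x_\ell)))_{\ell=0}^{k-1}\big)$, $k=0,1,2,\dots$. Theorem 2. Let $r>0$, $M>0$, let $T\ge 1$ and $d\ge T$ be integers (for instance $d=T$), let $x_{\mathrm{ref}}\in\mathbb{H}^d$,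 and put $\zeta_r=r/\tanh(r)$. For every deterministic first-order algorithm $\mathcal{A}$ on $\mathbb{H}^d$ there is a g-convex function $f\colon\mathbb{H}^d\to\mathbb{R}$ which is $M$-Lipschitz (that is, $|f(x)-f(y)|\le M\,\mathrm{dist}(x,y)$ for all $x,y$), has a global minimizer in the closed ball $\{x:\mathrm{dist}(x,x_{\mathrm{ref}})\le r\}$, has a subgradient at every point, and is such that $\mathcal{A}$ requires at least $T$ queries to reach accuracy $Mr\cdot\frac{1}{2\zeta_r\sqrt{T}}$: whatever the oracle for $f$, the first index $k$ (if there is one) with $$f(x_k)-f^*\le Mr\cdot\frac{1}{2\zeta_r\sqrt{T}},\qquad f^*=\min_{x\in\mathbb{H}^d}f(x),$$ satisfies $k\ge T$. -/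

import Mathlib

noncomputable section

namespace Hyp

/-! ## The hyperboloid model of `d`-dimensional hyperbolic space of curvature `-1` -/

/-- The ambient vector space `ℝ × ℝ^d` of the hyperboloid model (time coordinate first). -/
abbrev Ambient (d : ℕ) : Type := ℝ × EuclideanSpace ℝ (Fin d)

/-- The Minkowski form `⟪p, q⟫ = p₁ q₁ + ⋯ + p_d q_d - p₀ q₀`. -/
def mink {d : ℕ} (p q : Ambient d) : ℝ := inner ℝ p.2 q.2 - p.1 * q.1

theorem mink_comm {d : ℕ} (p q : Ambient d) : mink p q = mink q p := by
  simp only [mink, real_inner_comm, mul_comm]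

theorem mink_add_right {d : ℕ} (p q q' : Ambient d) :
    mink p (q + q') = mink p q + mink p q' := by
  simp only [mink, Prod.fst_add, Prod.snd_add, inner_add_right]; ring

theorem mink_smul_right {d : ℕ} (c : ℝ) (p q : Ambient d) :
    mink p (c • q) = c * mink p q := by
  simp only [mink, Prod.smul_fst, Prod.smul_snd, inner_smul_right, smul_eq_mul]; ring

theorem mink_add_left {d : ℕ} (p p' q : Ambient d) :
    mink (p + p') q = mink p q + mink p' q := by
  rw [mink_comm, mink_add_right, mink_comm q, mink_comm q]

theorem mink_smul_left {d : ℕ} (c : ℝ) (p q : Ambient d) :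
    mink (c • p) q = c * mink p q := by
  rw [mink_comm, mink_smul_right, mink_comm q]

/-- Hyperbolic space `ℍ^d`: the upper sheet of the hyperboloid `⟪p, p⟫ = -1`. -/
def Space (d : ℕ) : Type := {p : Ambient d // mink p p = -1 ∧ 0 < p.1}

/-- The tangent space `T_x ℍ^d`, the Minkowski-orthogonal complement of `x`.  The Riemannian
metric on it is the restriction of the Minkowski form. -/
def TangentAt {d : ℕ} (x : Space d) : Submodule ℝ (Ambient d) where
  carrier := {v | mink x.1 v = 0}
  add_mem' {v w} hv hw := by
    simp only [Set.mem_ofPred_eq] at hv hw ⊢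
    rw [mink_add_right, hv, hw, add_zero]
  zero_mem' := by simp [mink]
  smul_mem' c v hv := by
    simp only [Set.mem_ofPred_eq] at hv ⊢
    rw [mink_smul_right, hv, mul_zero]

/-- The tangent bundle of `ℍ^d`. -/
abbrev TBundle (d : ℕ) : Type := Σ x : Space d, TangentAt x

/-- The Riemannian norm `‖v‖ = √⟪v, v⟫` of a tangent vector. -/
def tnorm {d : ℕ} {x : Space d} (v : TangentAt x) : ℝ := √(mink v.1 v.1)

/-- The Riemannian distance on `ℍ^d`, given by `cosh (dist x y) = -⟪x, y⟫`. -/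
def hdist {d : ℕ} (x y : Space d) : ℝ := Real.arcosh (-mink x.1 y.1)

theorem sq_time_eq {d : ℕ} (x : Space d) : x.1.1 ^ 2 = 1 + ‖x.1.2‖ ^ 2 := by
  have h := x.2.1
  simp only [mink, real_inner_self_eq_norm_sq] at h
  nlinarith

/-- A quantitative form of positive definiteness of the Minkowski form on `T_x ℍ^d`. -/
theorem tangent_time_sq_le {d : ℕ} (x : Space d) (v : TangentAt x) :
    v.1.1 ^ 2 ≤ (x.1.1 ^ 2 - 1) * mink v.1 v.1 := by
  have h0 : inner ℝ x.1.2 v.1.2 = x.1.1 * v.1.1 := by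
    have h : inner ℝ x.1.2 v.1.2 - x.1.1 * v.1.1 = 0 := v.2
    linarith
  have hcs : (inner ℝ x.1.2 v.1.2 : ℝ) ^ 2 ≤ ‖x.1.2‖ ^ 2 * ‖v.1.2‖ ^ 2 := by
    rw [← mul_pow]
    exact sq_le_sq' (by have := abs_real_inner_le_norm x.1.2 v.1.2; rw [abs_le] at this; linarith)
      (real_inner_le_norm _ _)
  rw [h0] at hcs
  have hx := sq_time_eq x
  have : mink v.1 v.1 = ‖v.1.2‖ ^ 2 - v.1.1 ^ 2 := by
    simp only [mink, real_inner_self_eq_norm_sq]; ring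
  rw [this]
  have e : ‖x.1.2‖ ^ 2 = x.1.1 ^ 2 - 1 := by linarith
  rw [e] at hcs
  nlinarith

theorem one_le_time {d : ℕ} (x : Space d) : 1 ≤ x.1.1 := by
  have h := sq_time_eq x
  have h' := x.2.2
  nlinarith [sq_nonneg ‖x.1.2‖]

theorem mink_tangent_nonneg {d : ℕ} (x : Space d) (v : TangentAt x) : 0 ≤ mink v.1 v.1 := by
  have h := tangent_time_sq_le x v
  have h1 := one_le_time x
  have h2 : mink v.1 v.1 = ‖v.1.2‖ ^ 2 - v.1.1 ^ 2 := by
    simp only [mink, real_inner_self_eq_norm_sq]; ring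
  by_contra hc
  push Not at hc
  have h3 : (x.1.1 ^ 2 - 1) * mink v.1 v.1 ≤ 0 :=
    mul_nonpos_of_nonneg_of_nonpos (by nlinarith) hc.le
  nlinarith [sq_nonneg ‖v.1.2‖, sq_nonneg v.1.1]

theorem tnorm_sq {d : ℕ} {x : Space d} (v : TangentAt x) : tnorm v ^ 2 = mink v.1 v.1 :=
  Real.sq_sqrt (mink_tangent_nonneg x v)

theorem tnorm_nonneg {d : ℕ} {x : Space d} (v : TangentAt x) : 0 ≤ tnorm v := Real.sqrt_nonneg _

theorem eq_zero_of_tnorm_eq_zero {d : ℕ} {x : Space d} {v : TangentAt x} (h : tnorm v = 0) :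
    v = 0 := by
  have h0 : mink v.1 v.1 = 0 := by rw [← tnorm_sq, h]; norm_num
  have h1 := tangent_time_sq_le x v
  rw [h0, mul_zero] at h1
  have h2 : v.1.1 = 0 := by nlinarith [sq_nonneg v.1.1]
  have h3 : mink v.1 v.1 = ‖v.1.2‖ ^ 2 - v.1.1 ^ 2 := by
    simp only [mink, real_inner_self_eq_norm_sq]; ring
  have h4 : ‖v.1.2‖ = 0 := by
    rw [h0, h2] at h3
    nlinarith [sq_nonneg ‖v.1.2‖]
  exact Subtype.ext (Prod.ext h2 (norm_eq_zero.mp h4))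

/-- The exponential map `exp_x v = cosh ‖v‖ x + (sinh ‖v‖ / ‖v‖) v` (equal to `x` at `v = 0`). -/
def expMap {d : ℕ} (x : Space d) (v : TangentAt x) : Space d :=
  ⟨Real.cosh (tnorm v) • x.1 + (Real.sinh (tnorm v) / tnorm v) • v.1, by
    have hv : mink x.1 v.1 = 0 := v.2
    have hv' : mink v.1 x.1 = 0 := by rw [mink_comm]; exact hv
    have hn := tnorm_sq v
    have hn0 := tnorm_nonneg v
    constructor
    · simp only [mink_add_left, mink_add_right, mink_smul_left, mink_smul_right, hv, hv', x.2.1,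
        ← hn]
      rcases eq_or_ne (tnorm v) 0 with h | h
      · simp [h]
      · field_simp
        nlinarith [Real.cosh_sq (tnorm v)]
    · have hx := one_le_time x
      have ht := tangent_time_sq_le x v
      rw [← hn] at ht
      simp only [Prod.fst_add, Prod.smul_fst, smul_eq_mul]
      rcases eq_or_ne (tnorm v) 0 with h | h
      · simp only [h, Real.cosh_zero, Real.sinh_zero]; simp; linarith
      · have hp : 0 < tnorm v := lt_of_le_of_ne hn0 (Ne.symm h)
        have hs : 0 < Real.sinh (tnorm v) := Real.sinh_pos_iff.mpr hp
        have hc : Real.sinh (tnorm v) < Real.cosh (tnorm v) := Real.sinh_lt_cosh _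
        have habs : |v.1.1| ≤ x.1.1 * tnorm v :=
          abs_le_of_sq_le_sq (by nlinarith [sq_nonneg (tnorm v)]) (by positivity)
        have h1 : -(x.1.1 * tnorm v) ≤ v.1.1 := (abs_le.mp habs).1
        have h2 : Real.sinh (tnorm v) / tnorm v * -(x.1.1 * tnorm v)
            ≤ Real.sinh (tnorm v) / tnorm v * v.1.1 :=
          mul_le_mul_of_nonneg_left h1 (by positivity)
        have h3 : Real.sinh (tnorm v) / tnorm v * -(x.1.1 * tnorm v)
            = -(Real.sinh (tnorm v) * x.1.1) := by field_simp
        nlinarith [mul_lt_mul_of_pos_right hc x.2.2]⟩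

/-- The logarithm `log_x y = (D / sinh D) (y - cosh D x)` with `D = dist x y` (zero at `y = x`);
it is the inverse of `exp_x`, see `expMap_logMap` and `logMap_expMap` below. -/
def logMap {d : ℕ} (x y : Space d) : TangentAt x :=
  ⟨(hdist x y / Real.sinh (hdist x y)) • (y.1 + mink x.1 y.1 • x.1), by
    change mink _ _ = 0
    rw [mink_smul_right, mink_add_right, mink_smul_right, x.2.1]; ring⟩

theorem mink_diff {d : ℕ} (x y : Space d) :
    mink (y.1 + mink x.1 y.1 • x.1) (y.1 + mink x.1 y.1 • x.1) = mink x.1 y.1 ^ 2 - 1 := by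
  simp only [mink_add_left, mink_add_right, mink_smul_left, mink_smul_right, x.2.1, y.2.1,
    mink_comm y.1 x.1]
  ring

theorem one_le_neg_mink {d : ℕ} (x y : Space d) : 1 ≤ -mink x.1 y.1 := by
  have hmem : y.1 + mink x.1 y.1 • x.1 ∈ TangentAt x := by
    change mink _ _ = 0
    rw [mink_add_right, mink_smul_right, x.2.1]; ring
  have h := mink_tangent_nonneg x ⟨_, hmem⟩
  simp only [mink_diff] at h
  have hneg : mink x.1 y.1 < 0 := by
    have hx := sq_time_eq x
    have hy := sq_time_eq y
    have hi := real_inner_le_norm x.1.2 y.1.2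
    have h1 : ‖x.1.2‖ < x.1.1 := lt_of_pow_lt_pow_left₀ 2 x.2.2.le (by linarith)
    have h2 : ‖y.1.2‖ < y.1.1 := lt_of_pow_lt_pow_left₀ 2 y.2.2.le (by linarith)
    have h3 := mul_lt_mul'' h1 h2 (norm_nonneg _) (norm_nonneg _)
    simp only [mink]; linarith
  nlinarith

theorem cosh_hdist {d : ℕ} (x y : Space d) : Real.cosh (hdist x y) = -mink x.1 y.1 :=
  Real.cosh_arcosh (one_le_neg_mink x y)

theorem hdist_nonneg {d : ℕ} (x y : Space d) : 0 ≤ hdist x y :=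
  Real.arcosh_nonneg (one_le_neg_mink x y)

theorem tnorm_logMap {d : ℕ} (x y : Space d) : tnorm (logMap x y) = hdist x y := by
  have hD := hdist_nonneg x y
  have hs : 0 ≤ Real.sinh (hdist x y) := Real.sinh_nonneg_iff.mpr hD
  unfold tnorm logMap
  simp only [mink_smul_left, mink_smul_right, mink_diff]
  have h1 : mink x.1 y.1 ^ 2 - 1 = Real.sinh (hdist x y) ^ 2 := by
    have := cosh_hdist x y
    have h2 := Real.cosh_sq (hdist x y)
    rw [this] at h2; linarith
  rw [h1, ← mul_assoc]
  rcases eq_or_lt_of_le hD with h | h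
  · rw [← h]; simp
  · have hs' : Real.sinh (hdist x y) ≠ 0 := (Real.sinh_pos_iff.mpr h).ne'
    rw [Real.sqrt_eq_iff_mul_self_eq (by positivity) hD]
    field_simp

theorem expMap_logMap {d : ℕ} (x y : Space d) : expMap x (logMap x y) = y := by
  have hD := hdist_nonneg x y
  apply Subtype.ext
  change Real.cosh (tnorm (logMap x y)) • x.1
    + (Real.sinh (tnorm (logMap x y)) / tnorm (logMap x y)) • (logMap x y).1 = y.1
  rw [tnorm_logMap, cosh_hdist]
  rcases eq_or_lt_of_le hD with h | h
  · have hm : -mink x.1 y.1 = 1 := by rw [← cosh_hdist, ← h, Real.cosh_zero]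
    have hmem : y.1 + mink x.1 y.1 • x.1 ∈ TangentAt x := by
      change mink _ _ = 0
      rw [mink_add_right, mink_smul_right, x.2.1]; ring
    have h0 : tnorm (⟨_, hmem⟩ : TangentAt x) = 0 := by
      unfold tnorm
      rw [mink_diff, Real.sqrt_eq_zero']; nlinarith
    have h1 := congrArg Subtype.val (eq_zero_of_tnorm_eq_zero h0)
    have hm' : mink x.1 y.1 = -1 := by linarith
    simp only [hm', neg_smul, one_smul, ZeroMemClass.coe_zero] at h1
    rw [hm, ← h, Real.sinh_zero, zero_div, zero_smul, add_zero, one_smul]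
    exact (add_neg_eq_zero.mp h1).symm
  · have hs : Real.sinh (hdist x y) ≠ 0 := (Real.sinh_pos_iff.mpr h).ne'
    simp only [logMap, smul_smul]
    have : Real.sinh (hdist x y) / hdist x y * (hdist x y / Real.sinh (hdist x y)) = 1 := by
      field_simp
    rw [this, one_smul, neg_smul]
    abel

theorem hdist_expMap {d : ℕ} (x : Space d) (v : TangentAt x) :
    hdist x (expMap x v) = tnorm v := by
  have hv : mink x.1 v.1 = 0 := v.2
  have : -mink x.1 (expMap x v).1 = Real.cosh (tnorm v) := by
    change -mink x.1 (Real.cosh (tnorm v) • x.1 + (Real.sinh (tnorm v) / tnorm v) • v.1) = _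
    rw [mink_add_right, mink_smul_right, mink_smul_right, hv, x.2.1]; ring
  rw [hdist, this, Real.arcosh_cosh (tnorm_nonneg v)]

theorem logMap_expMap {d : ℕ} (x : Space d) (v : TangentAt x) : logMap x (expMap x v) = v := by
  rcases eq_or_lt_of_le (tnorm_nonneg v) with h | h
  · have h1 : tnorm (logMap x (expMap x v)) = 0 := by rw [tnorm_logMap, hdist_expMap, ← h]
    rw [eq_zero_of_tnorm_eq_zero h1, eq_zero_of_tnorm_eq_zero h.symm]
  · have hv : mink x.1 v.1 = 0 := v.2
    have hs : Real.sinh (tnorm v) ≠ 0 := (Real.sinh_pos_iff.mpr h).ne'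
    have hm : mink x.1 (expMap x v).1 = -Real.cosh (tnorm v) := by
      rw [← hdist_expMap, cosh_hdist, neg_neg]
    apply Subtype.ext
    change (hdist x (expMap x v) / Real.sinh (hdist x (expMap x v))) •
      ((expMap x v).1 + mink x.1 (expMap x v).1 • x.1) = v.1
    rw [hdist_expMap, hm]
    change (tnorm v / Real.sinh (tnorm v)) • ((Real.cosh (tnorm v) • x.1
      + (Real.sinh (tnorm v) / tnorm v) • v.1) + (-Real.cosh (tnorm v)) • x.1) = v.1
    have : Real.cosh (tnorm v) • x.1 + (Real.sinh (tnorm v) / tnorm v) • v.1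
        + (-Real.cosh (tnorm v)) • x.1 = (Real.sinh (tnorm v) / tnorm v) • v.1 := by
      rw [neg_smul]; abel
    rw [this, smul_smul]
    have : tnorm v / Real.sinh (tnorm v) * (Real.sinh (tnorm v) / tnorm v) = 1 := by field_simp
    rw [this, one_smul]

/-- The geodesic `γ` with `γ 0 = x` and `γ 1 = y`, namely `γ t = exp_x (t log_x y)`. -/
def geodesic {d : ℕ} (x y : Space d) (t : ℝ) : Space d := expMap x (t • logMap x y)

/-! ## Geodesically convex functions, subgradients and the function class -/

/-- `f` is geodesically convex on `ℍ^d`. -/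
def GConvex {d : ℕ} (f : Space d → ℝ) : Prop :=
  ∀ x y : Space d, ∀ t ∈ Set.Icc (0 : ℝ) 1, f (geodesic x y t) ≤ (1 - t) * f x + t * f y

/-- `f` is globally `M`-Lipschitz on `ℍ^d`. -/
def IsLipschitz {d : ℕ} (M : ℝ) (f : Space d → ℝ) : Prop :=
  ∀ x y : Space d, |f x - f y| ≤ M * hdist x y

/-- The subdifferential `∂f(x)`: all `g ∈ T_x ℍ^d` with `f y ≥ f x + ⟪g, log_x y⟫` for all `y`. -/
def subdifferential {d : ℕ} (f : Space d → ℝ) (x : Space d) : Set (TangentAt x) :=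
  {g | ∀ y : Space d, f x + mink g.1 (logMap x y).1 ≤ f y}

/-- The class of `M`-Lipschitz g-convex functions on `ℍ^d` which have a global minimizer in the
closed ball of radius `r` around `xref`. -/
def lipschitzClass {d : ℕ} (xref : Space d) (r M : ℝ) : Set (Space d → ℝ) :=
  {f | IsLipschitz M f ∧ GConvex f ∧ ∃ xmin : Space d, hdist xmin xref ≤ r ∧ ∀ y, f xmin ≤ f y}

/-! ## Deterministic first-order algorithms -/

/-- What an oracle returns at a query `x`: a function value and a tangent vector (the tangent
vector comes with its base point `x`). -/
abbrev Answer (d : ℕ) : Type := ℝ × TBundle d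

/-- A deterministic first-order algorithm: the `k`-th query is an arbitrary function of the
answers to the first `k` queries. -/
def Algorithm (d : ℕ) : Type := (k : ℕ) → (Fin k → Answer d) → Space d

/-- A first-order oracle for `f`, that is, a choice of a subgradient of `f` at every point. -/
structure Oracle {d : ℕ} (f : Space d → ℝ) where
  subgrad : ∀ x : Space d, TangentAt x
  subgrad_mem : ∀ x : Space d, subgrad x ∈ subdifferential f x

/-- The answer of the oracle to the query `x`. -/
def Oracle.answer {d : ℕ} {f : Space d → ℝ} (O : Oracle f) (x : Space d) : Answer d :=
  (f x, ⟨x, O.subgrad x⟩)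

/-- The answers to the first `k` queries when the algorithm is run with the oracle `O`. -/
def history {d : ℕ} {f : Space d → ℝ} (A : Algorithm d) (O : Oracle f) :
    (k : ℕ) → Fin k → Answer d
  | 0 => Fin.elim0
  | k + 1 => Fin.snoc (α := fun _ => Answer d) (history A O k) (O.answer (A k (history A O k)))

/-- The queries `x₀, x₁, …` when the algorithm is run with the oracle `O`. -/
def query {d : ℕ} {f : Space d → ℝ} (A : Algorithm d) (O : Oracle f) (k : ℕ) : Space d :=
  A k (history A O k)

/-- The first `k` with `f (x_k) - f^* ≤ δ` (`⊤` if there is none), where `f^* = inf f`. -/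
def queryComplexity {d : ℕ} {f : Space d → ℝ} (A : Algorithm d) (O : Oracle f) (δ : ℝ) : ℕ∞ :=
  ⨅ (k : ℕ) (_ : f (query A O k) - (⨅ y, f y) ≤ δ), (k : ℕ∞)

/-- The curvature quantity `ζ_r = r / tanh r`. -/
def zeta (r : ℝ) : ℝ := r / Real.tanh r

end Hyp

end

noncomputable section

namespace Hyp

/-! ## Scalar inequalities -/

/-! The proof is a resisting-oracle argument. Put `δ = tanh r / √T`, so that the target accuracy is
`M δ / 2`. In an orthonormal frame of the tangent space at `xref`, each new query is met with a
half-space whose boundary lies at distance `δ` from `xref`, in an unused frame direction where the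
query has the largest coordinate, on the side opposite to the query. The query is then at distance
at least `δ` from that half-space (`le_arsinh_resistedNormal_query`). The hard function is
essentially `M` times the maximum of the distances to `T` such half-spaces. By hyperbolic
trigonometry they share a point within `r` of `xref` (`exists_mink_normal_nonpos`), so the minimum
is `0`, while each of the first `T` queries has value near `M δ` or more.

Consistency rests on the greedy choice: at the `k`-th query no later half-space is farther away than
the `k`-th (`mink_resistedNormal_le`). A plain maximum would have ties and hence several
subgradients, whereas the bound must hold for every oracle. The maximum is therefore smoothed by
`ramp`, with the `l`-th distance lowered by `l η`: later half-spaces then leave earlier values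
unchanged (`envelope_eq_of_le`), and differentiability leaves only one possible subgradient
(`subdifferential_subsingleton`). Every run thus coincides with the resisted one
(`history_eq_resistance`).

Convexity and the Lipschitz bound both come from exhibiting subgradients of norm at most one. They
exist for the distance to a half-space and survive the smoothed maximum. -/

theorem sinh_mul_le {p D : ℝ} (hp0 : 0 ≤ p) (hp1 : p ≤ 1) (hD : 0 ≤ D) :
    Real.sinh (D * p) ≤ p * Real.sinh D := by
  have hder : ∀ t : ℝ, HasDerivAt (fun t => p * Real.sinh t - Real.sinh (t * p))
      (p * Real.cosh t - Real.cosh (t * p) * p) t := fun t =>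
    ((Real.hasDerivAt_sinh t).const_mul p).sub
      (((hasDerivAt_id t).mul_const p).sinh.congr_deriv (by simp))
  have hmono : MonotoneOn (fun t => p * Real.sinh t - Real.sinh (t * p)) (Set.Ici 0) := by
    refine monotoneOn_of_deriv_nonneg (convex_Ici 0)
      (fun t _ => (hder t).continuousAt.continuousWithinAt)
      (fun t _ => (hder t).differentiableAt.differentiableWithinAt) fun t ht => ?_
    rw [interior_Ici, Set.mem_Ioi] at ht
    rw [(hder t).deriv]
    have : Real.cosh (t * p) ≤ Real.cosh t := by
      rw [Real.cosh_le_cosh, abs_of_nonneg (by positivity), abs_of_pos ht]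
      nlinarith
    nlinarith
  have := hmono (Set.mem_Ici.2 le_rfl) (Set.mem_Ici.2 hD) hD
  simp at this
  linarith

/-- Concavity of `tanh` on the half-line, `p tanh D ≤ tanh (D p)`, with denominators cleared. -/
theorem mul_sinh_mul_cosh_le {p D : ℝ} (hp0 : 0 ≤ p) (hp1 : p ≤ 1) (hD : 0 ≤ D) :
    p * Real.sinh D * Real.cosh (D * p) ≤ Real.cosh D * Real.sinh (D * p) := by
  have hder : ∀ t : ℝ, HasDerivAt
      (fun t => Real.cosh t * Real.sinh (t * p) - p * Real.sinh t * Real.cosh (t * p))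
      ((1 - p ^ 2) * (Real.sinh t * Real.sinh (t * p))) t := fun t => by
    have h1 : HasDerivAt (fun t : ℝ => t * p) p t := by simpa using (hasDerivAt_id t).mul_const p
    refine (((Real.hasDerivAt_cosh t).mul h1.sinh).sub
      (((Real.hasDerivAt_sinh t).const_mul p).mul h1.cosh)).congr_deriv ?_
    ring
  have hmono : MonotoneOn
      (fun t => Real.cosh t * Real.sinh (t * p) - p * Real.sinh t * Real.cosh (t * p))
      (Set.Ici 0) := by
    refine monotoneOn_of_deriv_nonneg (convex_Ici 0)
      (fun t _ => (hder t).continuousAt.continuousWithinAt)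
      (fun t _ => (hder t).differentiableAt.differentiableWithinAt) fun t ht => ?_
    rw [interior_Ici, Set.mem_Ioi] at ht
    rw [(hder t).deriv]
    have h1 : 0 ≤ Real.sinh t := Real.sinh_nonneg_iff.2 ht.le
    have h2 : 0 ≤ Real.sinh (t * p) := Real.sinh_nonneg_iff.2 (by positivity)
    have h3 : 0 ≤ 1 - p ^ 2 := by nlinarith
    positivity
  have := hmono (Set.mem_Ici.2 le_rfl) (Set.mem_Ici.2 hD) hD
  simp at this
  linarith

/-- The tangent line inequality behind the convexity of the distance to a half-space. -/
theorem sinh_add_mul_le {a D q : ℝ} (ha : 0 ≤ a) (hD : 0 ≤ D) (hq : |q| ≤ 1)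
    (h : 0 ≤ a + D * q) :
    Real.sinh (a + D * q) ≤ Real.cosh D * Real.sinh a + q * Real.sinh D * Real.cosh a := by
  have hsa : 0 ≤ Real.sinh a := Real.sinh_nonneg_iff.2 ha
  have hca : 0 < Real.cosh a := Real.cosh_pos a
  have hX : Real.cosh (D * q) ≤ Real.cosh D := by
    rw [Real.cosh_le_cosh, abs_mul, abs_of_nonneg hD]
    nlinarith [abs_nonneg q]
  rcases le_total 0 q with h0 | h0
  · have h1 := sinh_mul_le h0 (abs_le.1 hq).2 hD
    rw [Real.sinh_add]
    nlinarith
  · obtain ⟨p, rfl⟩ : ∃ p, q = -p := ⟨-q, by ring⟩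
    have hp0 : 0 ≤ p := by linarith
    have hp1 : p ≤ 1 := by rwa [abs_neg, abs_of_nonneg hp0] at hq
    have h2 := mul_sinh_mul_cosh_le hp0 hp1 hD
    have hs := Real.sinh_nonneg_iff.2 h
    rw [mul_neg, Real.sinh_add, Real.cosh_neg, Real.sinh_neg] at hs ⊢
    rw [mul_neg, Real.cosh_neg] at hX
    have hc : 0 < Real.cosh (D * p) := Real.cosh_pos _
    -- After multiplication by `cosh (D p)` the gap splits into two nonnegative products: `sinh (a -
    -- D p) (cosh D - cosh (D p))` and `cosh a` times the gap in `h2`.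
    have h3 : 0 ≤ Real.cosh (D * p) *
        (Real.cosh D * Real.sinh a + -p * Real.sinh D * Real.cosh a
          - (Real.sinh a * Real.cosh (D * p) + Real.cosh a * -Real.sinh (D * p))) := by
      have h4 := mul_nonneg hs (sub_nonneg.2 hX)
      have h5 := mul_nonneg hca.le (sub_nonneg.2 h2)
      linarith
    have := nonneg_of_mul_nonneg_right h3 hc
    linarith

theorem sinh_le_mul_cosh {x : ℝ} (hx : 0 ≤ x) : Real.sinh x ≤ x * Real.cosh x := by
  have hder : ∀ t : ℝ, HasDerivAt (fun t => t * Real.cosh t - Real.sinh t)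
      (t * Real.sinh t) t := fun t =>
    (((hasDerivAt_id t).mul (Real.hasDerivAt_cosh t)).sub
      (Real.hasDerivAt_sinh t)).congr_deriv (by simp)
  have hmono : MonotoneOn (fun t => t * Real.cosh t - Real.sinh t) (Set.Ici 0) := by
    refine monotoneOn_of_deriv_nonneg (convex_Ici 0)
      (fun t _ => (hder t).continuousAt.continuousWithinAt)
      (fun t _ => (hder t).differentiableAt.differentiableWithinAt) fun t ht => ?_
    rw [interior_Ici, Set.mem_Ioi] at ht
    rw [(hder t).deriv]
    exact mul_nonneg ht.le (Real.sinh_nonneg_iff.2 ht.le)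
  have := hmono (Set.mem_Ici.2 le_rfl) (Set.mem_Ici.2 hx) hx
  simp at this
  linarith

/-! ## A smooth positive part -/

/-- A `C¹` convex approximation of `max t 0` with slopes in `[0, 1]`, exact for `t ≤ 0`. -/
def ramp (η t : ℝ) : ℝ := √(η ^ 2 + max t 0 ^ 2) - η

theorem ramp_nonneg {η : ℝ} (t : ℝ) : 0 ≤ ramp η t :=
  sub_nonneg.2 (Real.le_sqrt_of_sq_le (by nlinarith [sq_nonneg (max t 0)]))

theorem ramp_of_nonpos {η t : ℝ} (hη : 0 ≤ η) (ht : t ≤ 0) : ramp η t = 0 := by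
  simp [ramp, max_eq_right ht, Real.sqrt_sq hη]

theorem sub_le_ramp {η : ℝ} (t : ℝ) : t - η ≤ ramp η t := by
  have h : max t 0 ≤ √(η ^ 2 + max t 0 ^ 2) :=
    Real.le_sqrt_of_sq_le (by nlinarith [sq_nonneg η])
  have := le_max_left t 0
  unfold ramp
  linarith

/-- Squaring removes the kink of the positive part: the first-order remainder is at most `(y - t)²`.
-/
theorem hasDerivAt_max_zero_sq (t : ℝ) :
    HasDerivAt (fun t : ℝ => max t 0 ^ 2) (2 * max t 0) t := by
  rw [hasDerivAt_iff_isLittleO]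
  refine (Asymptotics.IsBigO.of_bound (c := 1) (g := fun y => (y - t) * (y - t))
    (Filter.Eventually.of_forall fun y => ?_)).trans_isLittleO ?_
  · rw [one_mul, Real.norm_eq_abs, Real.norm_eq_abs, abs_mul_self, smul_eq_mul, abs_le]
    rcases max_cases t 0 with ⟨h1, h2⟩ | ⟨h1, h2⟩ <;>
      rcases max_cases y 0 with ⟨h3, h4⟩ | ⟨h3, h4⟩ <;> rw [h1, h3] <;>
      constructor <;> nlinarith
  · have h : Filter.Tendsto (fun y : ℝ => y - t) (nhds t) (nhds 0) := by
      have : Continuous fun y : ℝ => y - t := by fun_prop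
      simpa using this.tendsto t
    simpa using ((Asymptotics.isLittleO_one_iff ℝ).2 h).mul_isBigO
      (Asymptotics.isBigO_refl (fun y : ℝ => y - t) (nhds t))

theorem differentiable_ramp {η : ℝ} (hη : 0 < η) : Differentiable ℝ (ramp η) := fun t =>
  ((((hasDerivAt_max_zero_sq t).const_add (η ^ 2)).sqrt (by positivity)).sub_const
    η).differentiableAt

theorem exists_slope_ramp {η : ℝ} (hη : 0 < η) (t : ℝ) :
    ∃ w, 0 ≤ w ∧ w ≤ 1 ∧ ∀ t', ramp η t + w * (t' - t) ≤ ramp η t' := by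
  set p := max t 0 with hp
  have hp0 : 0 ≤ p := le_max_right _ _
  have hpos : 0 < √(η ^ 2 + p ^ 2) := Real.sqrt_pos.2 (by positivity)
  have hsq : √(η ^ 2 + p ^ 2) ^ 2 = η ^ 2 + p ^ 2 := Real.sq_sqrt (by positivity)
  refine ⟨p / √(η ^ 2 + p ^ 2), by positivity, ?_, fun t' => ?_⟩
  · rw [div_le_one hpos]
    exact Real.le_sqrt_of_sq_le (by nlinarith [sq_nonneg η])
  · set p' := max t' 0 with hp'
    -- Cauchy–Schwarz for `(η, p)` and `(η, p')`: the supporting line of the Euclidean norm at `(η,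
    -- p)`.
    have hcs : η ^ 2 + p * p' ≤ √(η ^ 2 + p' ^ 2) * √(η ^ 2 + p ^ 2) := by
      rw [← Real.sqrt_mul (by positivity)]
      exact Real.le_sqrt_of_sq_le (by nlinarith [sq_nonneg (η * p' - η * p)])
    have h1 : p * (t' - t) ≤ p * (p' - p) := by
      rcases max_cases t 0 with ⟨h1, h2⟩ | ⟨h1, h2⟩
      · have : p = t := h1
        have h3 : t' ≤ p' := le_max_left _ _
        exact mul_le_mul_of_nonneg_left (by linarith) hp0
      · have : p = 0 := h1
        simp [this]
    have h2 : √(η ^ 2 + p ^ 2) + p / √(η ^ 2 + p ^ 2) * (t' - t) ≤ √(η ^ 2 + p' ^ 2) := by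
      refine le_of_mul_le_mul_right ?_ hpos
      have h3 : (√(η ^ 2 + p ^ 2) + p / √(η ^ 2 + p ^ 2) * (t' - t)) * √(η ^ 2 + p ^ 2)
          = √(η ^ 2 + p ^ 2) ^ 2 + p * (t' - t) := by field_simp
      rw [h3, hsq]
      nlinarith
    unfold ramp
    rw [← hp, ← hp']
    linarith

/-! ## The Minkowski form on tangent spaces -/

theorem mink_zero_left {d : ℕ} (p : Ambient d) : mink 0 p = 0 := by simp [mink]

theorem mink_zero_right {d : ℕ} (p : Ambient d) : mink p 0 = 0 := by simp [mink]

theorem mink_sub_right {d : ℕ} (p q q' : Ambient d) : mink p (q - q') = mink p q - mink p q' := by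
  rw [sub_eq_add_neg, ← neg_one_smul ℝ q', mink_add_right, mink_smul_right]; ring

theorem mink_sub_left {d : ℕ} (p p' q : Ambient d) : mink (p - p') q = mink p q - mink p' q := by
  rw [mink_comm, mink_sub_right, mink_comm q, mink_comm q]

theorem mink_sum_right {d : ℕ} {ι : Type*} (s : Finset ι) (p : Ambient d) (q : ι → Ambient d) :
    mink p (∑ i ∈ s, q i) = ∑ i ∈ s, mink p (q i) := by
  classical
  induction s using Finset.induction_on with
  | empty => simp [mink_zero_right]
  | insert i s hi ih => rw [Finset.sum_insert hi, Finset.sum_insert hi, mink_add_right, ih]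

theorem hdist_comm {d : ℕ} (x y : Space d) : hdist x y = hdist y x := by
  rw [hdist, hdist, mink_comm]

theorem mink_sq_le {d : ℕ} {x : Space d} (v w : TangentAt x) :
    mink v.1 w.1 ^ 2 ≤ mink v.1 v.1 * mink w.1 w.1 := by
  have h : ∀ t : ℝ, 0 ≤ mink w.1 w.1 * (t * t) + 2 * mink v.1 w.1 * t + mink v.1 v.1 := fun t => by
    have := mink_tangent_nonneg x (v + t • w)
    simp only [Submodule.coe_add, Submodule.coe_smul, mink_add_left, mink_add_right,
      mink_smul_left, mink_smul_right, mink_comm w.1 v.1] at this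
    linarith
  have := discrim_le_zero h
  rw [discrim] at this
  nlinarith

theorem tnorm_smul {d : ℕ} {x : Space d} (c : ℝ) (v : TangentAt x) :
    tnorm (c • v) = |c| * tnorm v := by
  unfold tnorm
  rw [Submodule.coe_smul, mink_smul_left, mink_smul_right, ← mul_assoc,
    Real.sqrt_mul (mul_self_nonneg c), Real.sqrt_mul_self_eq_abs]

theorem expMap_coe {d : ℕ} (x : Space d) (v : TangentAt x) :
    (expMap x v).1 = Real.cosh (tnorm v) • x.1 + (Real.sinh (tnorm v) / tnorm v) • v.1 := rfl

theorem expMap_zero {d : ℕ} (x : Space d) : expMap x 0 = x := by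
  apply Subtype.ext
  have : tnorm (0 : TangentAt x) = 0 := by simp [tnorm, mink_zero_left]
  rw [expMap_coe, this]
  simp

theorem expMap_smul_coe {d : ℕ} (x : Space d) (v : TangentAt x) (hv : tnorm v ≠ 0) (t : ℝ) :
    (expMap x (t • v)).1
      = Real.cosh (t * tnorm v) • x.1 + (Real.sinh (t * tnorm v) / tnorm v) • v.1 := by
  rw [expMap_coe, tnorm_smul, Submodule.coe_smul, smul_smul]
  rcases lt_trichotomy t 0 with h | rfl | h
  · rw [abs_of_neg h, neg_mul, Real.cosh_neg, Real.sinh_neg]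
    have h0 := h.ne
    congr 2
    field_simp
  · simp
  · rw [abs_of_pos h]
    have h0 := h.ne'
    congr 2
    field_simp

theorem mink_logMap {d : ℕ} {x : Space d} (g : TangentAt x) (y : Space d) :
    mink g.1 (logMap x y).1 = hdist x y / Real.sinh (hdist x y) * mink g.1 y.1 := by
  have hg : mink g.1 x.1 = 0 := by rw [mink_comm]; exact g.2
  change mink g.1 ((hdist x y / Real.sinh (hdist x y)) • (y.1 + mink x.1 y.1 • x.1)) = _
  rw [mink_smul_right, mink_add_right, mink_smul_right, hg]
  ring

theorem eq_of_hdist_eq_zero {d : ℕ} {x y : Space d} (h : hdist x y = 0) : y = x := by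
  have h1 : logMap x y = 0 := eq_zero_of_tnorm_eq_zero (by rw [tnorm_logMap, h])
  rw [← expMap_logMap x y, h1, expMap_zero]

/-! ## Subgradients -/

/-- A subgradient at an interior point `z` of the geodesic is tested against both endpoints. Since
`(1 - t) log_z x + t log_z y = 0`, the linear terms cancel in the weighted sum. -/
theorem gconvex_of_subdifferential_nonempty {d : ℕ} {f : Space d → ℝ}
    (h : ∀ x, (subdifferential f x).Nonempty) : GConvex f := by
  rintro x y t ⟨ht0, ht1⟩
  rcases eq_or_lt_of_le ht0 with rfl | ht0
  · rw [geodesic, zero_smul, expMap_zero]; simp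
  rcases eq_or_lt_of_le ht1 with rfl | ht1
  · rw [geodesic, one_smul, expMap_logMap]; simp
  rcases eq_or_lt_of_le (hdist_nonneg x y) with hD | hD
  · have := eq_of_hdist_eq_zero hD.symm
    subst this
    have h0 : logMap y y = 0 := eq_zero_of_tnorm_eq_zero (by rw [tnorm_logMap, ← hD])
    rw [geodesic, h0, smul_zero, expMap_zero]
    linarith
  set D := hdist x y with hDdef
  set z := geodesic x y t with hz
  have hs : 0 < Real.sinh D := Real.sinh_pos_iff.2 hD
  have hzx : hdist z x = t * D := by
    rw [hdist_comm, hz, geodesic, hdist_expMap, tnorm_smul, tnorm_logMap, abs_of_pos ht0]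
  -- The geodesic as a combination of its endpoints in the ambient space; pairing with `g`
  -- annihilates the left side and relates the two endpoint pairings.
  have hzc : Real.sinh D • z.1
      = Real.sinh ((1 - t) * D) • x.1 + Real.sinh (t * D) • y.1 := by
    have hy : y.1 = Real.cosh D • x.1 + (Real.sinh D / D) • (logMap x y).1 := by
      conv_lhs => rw [← expMap_logMap x y, expMap_coe, tnorm_logMap]
    rw [hz, geodesic, expMap_smul_coe x _ (by rw [tnorm_logMap]; exact hD.ne'), tnorm_logMap,
      ← hDdef, hy, show (1 - t) * D = D - t * D by ring, Real.sinh_sub]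
    module
  have hzy : hdist z y = (1 - t) * D := by
    have h1 : Real.sinh D * mink z.1 y.1 = -(Real.sinh D * Real.cosh ((1 - t) * D)) := by
      rw [← mink_smul_left, hzc, mink_add_left, mink_smul_left, mink_smul_left, y.2.1,
        ← neg_neg (mink x.1 y.1), ← cosh_hdist, ← hDdef,
        show t * D = D - (1 - t) * D by ring, Real.sinh_sub]
      ring
    have h2 : -mink z.1 y.1 = Real.cosh ((1 - t) * D) := by
      have := mul_left_cancel₀ hs.ne' (h1.trans (mul_neg _ _).symm)
      linarith
    rw [hdist, h2, Real.arcosh_cosh (mul_nonneg (by linarith) hD.le)]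
  obtain ⟨g, hg⟩ := h z
  have hgz : mink g.1 z.1 = 0 := by rw [mink_comm]; exact g.2
  have hgxy : Real.sinh ((1 - t) * D) * mink g.1 x.1 + Real.sinh (t * D) * mink g.1 y.1 = 0 := by
    rw [← mink_smul_right, ← mink_smul_right, ← mink_add_right, ← hzc, mink_smul_right, hgz,
      mul_zero]
  have hx := hg x
  have hy := hg y
  rw [mink_logMap, hzx] at hx
  rw [mink_logMap, hzy] at hy
  have hs1 : 0 < Real.sinh (t * D) := Real.sinh_pos_iff.2 (by positivity)
  have hs2 : 0 < Real.sinh ((1 - t) * D) :=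
    Real.sinh_pos_iff.2 (mul_pos (by linarith) hD)
  have key : (1 - t) * (t * D / Real.sinh (t * D) * mink g.1 x.1)
      + t * ((1 - t) * D / Real.sinh ((1 - t) * D) * mink g.1 y.1) = 0 := by
    have : (1 - t) * (t * D / Real.sinh (t * D) * mink g.1 x.1)
      + t * ((1 - t) * D / Real.sinh ((1 - t) * D) * mink g.1 y.1)
      = (1 - t) * t * D / (Real.sinh (t * D) * Real.sinh ((1 - t) * D)) *
        (Real.sinh ((1 - t) * D) * mink g.1 x.1 + Real.sinh (t * D) * mink g.1 y.1) := by
      field_simp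
    rw [this, hgxy, mul_zero]
  have hx' := mul_le_mul_of_nonneg_left hx (by linarith : 0 ≤ 1 - t)
  have hy' := mul_le_mul_of_nonneg_left hy ht0.le
  linarith

/-- At every point `f` has a subgradient of Riemannian norm at most one. -/
def HasUnitSubgradients {d : ℕ} (f : Space d → ℝ) : Prop :=
  ∀ x, ∃ g ∈ subdifferential f x, ∀ v : TangentAt x, |mink g.1 v.1| ≤ tnorm v

theorem HasUnitSubgradients.isLipschitz_mul {d : ℕ} {f : Space d → ℝ} (h : HasUnitSubgradients f)
    {M : ℝ} (hM : 0 ≤ M) : IsLipschitz M fun x => M * f x := by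
  have key : ∀ x y, f x - f y ≤ hdist x y := fun x y => by
    obtain ⟨g, hg, hn⟩ := h x
    have h1 := hg y
    have h2 := hn (logMap x y)
    rw [tnorm_logMap] at h2
    have := (abs_le.1 h2).1
    linarith
  intro x y
  rw [← mul_sub, abs_mul, abs_of_nonneg hM]
  refine mul_le_mul_of_nonneg_left (abs_le.2 ⟨?_, key x y⟩) hM
  have := key y x
  rw [hdist_comm] at this
  linarith

theorem HasUnitSubgradients.subdifferential_mul_nonempty {d : ℕ} {f : Space d → ℝ}
    (h : HasUnitSubgradients f) {M : ℝ} (hM : 0 ≤ M) (x : Space d) :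
    (subdifferential (fun x => M * f x) x).Nonempty := by
  obtain ⟨g, hg, -⟩ := h x
  refine ⟨M • g, fun y => ?_⟩
  have := mul_le_mul_of_nonneg_left (hg y) hM
  rw [Submodule.coe_smul, mink_smul_left]
  linarith

theorem hasUnitSubgradients_zero {d : ℕ} : HasUnitSubgradients fun _ : Space d => (0 : ℝ) :=
  fun x => ⟨0, fun y => by simp [mink_zero_left], fun v => by
    simpa [mink_zero_left] using tnorm_nonneg v⟩

theorem HasUnitSubgradients.sub_const {d : ℕ} {f : Space d → ℝ} (h : HasUnitSubgradients f)
    (c : ℝ) : HasUnitSubgradients fun x => f x - c := fun x => by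
  obtain ⟨g, hg, hn⟩ := h x
  exact ⟨g, fun y => by have := hg y; linarith, hn⟩

/-- The slope `w` of the ramp lies in `[0, 1]`, so `(1 - w) g + w k` is a convex combination of
subgradients: it is again a subgradient and keeps the unit bound. -/
theorem HasUnitSubgradients.add_ramp {d : ℕ} {f h : Space d → ℝ} (hf : HasUnitSubgradients f)
    (hh : HasUnitSubgradients h) {η : ℝ} (hη : 0 < η) :
    HasUnitSubgradients fun x => f x + ramp η (h x - f x) := fun x => by
  obtain ⟨g, hg, hgn⟩ := hf x
  obtain ⟨k, hk, hkn⟩ := hh x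
  obtain ⟨w, hw0, hw1, hw⟩ := exists_slope_ramp hη (h x - f x)
  refine ⟨(1 - w) • g + w • k, fun y => ?_, fun v => ?_⟩
  · have h1 := mul_le_mul_of_nonneg_left (hg y) (sub_nonneg.2 hw1)
    have h2 := mul_le_mul_of_nonneg_left (hk y) hw0
    have h3 := hw (h y - f y)
    simp only [Submodule.coe_add, Submodule.coe_smul, mink_add_left, mink_smul_left]
    linarith
  · simp only [Submodule.coe_add, Submodule.coe_smul, mink_add_left, mink_smul_left]
    have h1 := mul_le_mul_of_nonneg_left (hgn v) (sub_nonneg.2 hw1)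
    have h2 := mul_le_mul_of_nonneg_left (hkn v) hw0
    refine (abs_add_le _ _).trans ?_
    rw [abs_mul, abs_mul, abs_of_nonneg (sub_nonneg.2 hw1), abs_of_nonneg hw0]
    linarith

/-! ### Distance to a half-space and its gradient. -/

theorem halfspace_gradient_mem {d : ℕ} (n : Ambient d) (x : Space d) :
    n + mink n x.1 • x.1 ∈ TangentAt x := by
  change mink _ _ = 0
  rw [mink_add_right, mink_smul_right, x.2.1, mink_comm]; ring

/-- The gradient at `x` of the signed distance to the hyperplane with unit normal `n`. -/
def halfspaceGradient {d : ℕ} (n : Ambient d) (x : Space d) : TangentAt x :=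
  (Real.cosh (Real.arsinh (mink n x.1)))⁻¹ • ⟨_, halfspace_gradient_mem n x⟩

theorem mink_halfspaceGradient {d : ℕ} (n : Ambient d) (x : Space d) (p : Ambient d) :
    Real.cosh (Real.arsinh (mink n x.1)) * mink (halfspaceGradient n x).1 p
      = mink n p + mink n x.1 * mink x.1 p := by
  have hca := (Real.cosh_pos (Real.arsinh (mink n x.1))).ne'
  rw [halfspaceGradient, Submodule.coe_smul, mink_smul_left, mink_add_left, mink_smul_left,
    mul_inv_cancel_left₀ hca]

theorem abs_mink_halfspaceGradient_le {d : ℕ} {n : Ambient d} (hn : mink n n = 1) (x : Space d)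
    (v : TangentAt x) : |mink (halfspaceGradient n x).1 v.1| ≤ tnorm v := by
  set a := Real.arsinh (mink n x.1) with ha
  have hca : 0 < Real.cosh a := Real.cosh_pos a
  have h1 := mink_sq_le (⟨_, halfspace_gradient_mem n x⟩ : TangentAt x) v
  have h2 : mink (n + mink n x.1 • x.1) (n + mink n x.1 • x.1) = Real.cosh a ^ 2 := by
    simp only [mink_add_left, mink_add_right, mink_smul_left, mink_smul_right, x.2.1, hn,
      mink_comm x.1 n, Real.cosh_sq, ha, Real.sinh_arsinh]
    ring
  simp only [h2] at h1
  rw [← tnorm_sq, ← mul_pow] at h1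
  have h3 := abs_le_of_sq_le_sq h1 (mul_nonneg hca.le (tnorm_nonneg v))
  have h4 := mink_halfspaceGradient n x v.1
  rw [← ha, ← mink_smul_left (mink n x.1), ← mink_add_left] at h4
  rw [← h4, abs_mul, abs_of_pos hca] at h3
  exact le_of_mul_le_mul_left h3 hca

/-- With `a` the signed distance at `x`, `D = dist x y` and `q` the initial slope along the geodesic
to `y`, one has `⟪n, y⟫ = cosh D sinh a + q sinh D cosh a`, and `sinh_add_mul_le` compares this with
`sinh (a + D q)`. When `a + D q ≤ 0`, truncation at zero suffices. -/
theorem halfspaceGradient_subgradient {d : ℕ} {n : Ambient d} (hn : mink n n = 1) {x : Space d}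
    (hu : 0 ≤ mink n x.1) (y : Space d) :
    Real.arsinh (mink n x.1) + mink (halfspaceGradient n x).1 (logMap x y).1
      ≤ max (Real.arsinh (mink n y.1)) 0 := by
  have hb := abs_mink_halfspaceGradient_le hn x (logMap x y)
  have hmval := mink_halfspaceGradient n x y.1
  have hsa : Real.sinh (Real.arsinh (mink n x.1)) = mink n x.1 := Real.sinh_arsinh _
  have hD0 : 0 ≤ hdist x y := hdist_nonneg x y
  have hcD := cosh_hdist x y
  rw [tnorm_logMap] at hb
  rcases eq_or_lt_of_le hD0 with hDz | hDpos
  · have := eq_of_hdist_eq_zero hDz.symm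
    subst this
    rw [← hDz] at hb
    rw [abs_nonpos_iff.1 hb, add_zero]
    exact le_max_left _ _
  rw [mink_logMap] at hb ⊢
  generalize mink (halfspaceGradient n x).1 y.1 = m at *
  have ha0 : 0 ≤ Real.arsinh (mink n x.1) := Real.arsinh_nonneg_iff.2 hu
  generalize Real.arsinh (mink n x.1) = a at *
  generalize hdist x y = D at *
  have hs : 0 < Real.sinh D := Real.sinh_pos_iff.2 hDpos
  have hgoal : D / Real.sinh D * m = D * (m / Real.sinh D) := by ring
  rw [hgoal] at hb ⊢
  have hq : |m / Real.sinh D| ≤ 1 := by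
    rw [abs_mul, abs_of_pos hDpos] at hb
    exact le_of_mul_le_mul_left (hb.trans_eq (mul_one D).symm) hDpos
  rcases le_total (a + D * (m / Real.sinh D)) 0 with h0 | h0
  · exact h0.trans (le_max_right _ _)
  · refine le_trans ?_ (le_max_left _ _)
    rw [← Real.sinh_le_sinh, Real.sinh_arsinh]
    refine (sinh_add_mul_le ha0 hD0 hq h0).trans (le_of_eq ?_)
    rw [div_mul_cancel₀ _ hs.ne', mul_comm m, hmval, hcD, hsa]
    ring

/-- The distance to a half-space has unit subgradients. -/
theorem hasUnitSubgradients_halfspace {d : ℕ} {n : Ambient d} (hn : mink n n = 1) :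
    HasUnitSubgradients fun x : Space d => max (Real.arsinh (mink n x.1)) 0 := fun x => by
  rcases le_total (mink n x.1) 0 with hu | hu
  · refine ⟨0, fun y => ?_, fun v => by simpa [mink_zero_left] using tnorm_nonneg v⟩
    have h0 : max (Real.arsinh (mink n x.1)) 0 = 0 :=
      max_eq_right (Real.arsinh_nonpos_iff.2 hu)
    have h1 : mink (0 : TangentAt x).1 (logMap x y).1 = 0 := mink_zero_left _
    change max (Real.arsinh (mink n x.1)) 0 + _ ≤ max (Real.arsinh (mink n y.1)) 0
    rw [h0, h1, add_zero]
    exact le_max_right _ _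
  · refine ⟨halfspaceGradient n x, fun y => ?_, abs_mink_halfspaceGradient_le hn x⟩
    have h0 : max (Real.arsinh (mink n x.1)) 0 = Real.arsinh (mink n x.1) :=
      max_eq_left (Real.arsinh_nonneg_iff.2 hu)
    change max (Real.arsinh (mink n x.1)) 0 + _ ≤ max (Real.arsinh (mink n y.1)) 0
    rw [h0]
    exact halfspaceGradient_subgradient hn hu y

/-- A function that extends differentiably to the ambient space has at most one subgradient. -/
theorem subdifferential_subsingleton {d : ℕ} {F : Ambient d → ℝ} (hF : Differentiable ℝ F)
    (x : Space d) : (subdifferential (fun y => F y.1) x).Subsingleton := by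
  have key : ∀ v : TangentAt x, tnorm v ≠ 0 → ∀ g ∈ subdifferential (fun y => F y.1) x,
      mink g.1 v.1 = deriv (fun t : ℝ => F (expMap x (t • v)).1) 0 := fun v hv g hg => by
    have hd : DifferentiableAt ℝ (fun t : ℝ => F (expMap x (t • v)).1) 0 := by
      simp only [expMap_smul_coe x v hv]
      have : Differentiable ℝ fun t : ℝ => Real.cosh (t * tnorm v) • x.1
          + (Real.sinh (t * tnorm v) / tnorm v) • v.1 := by fun_prop
      exact (hF.comp this) 0
    -- The subgradient inequality along `exp_x (t v)` for both signs of `t` forces `⟪g, v⟫` to be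
    -- the directional derivative.
    have hmin : IsLocalMin (fun t : ℝ => F (expMap x (t • v)).1 - t * mink g.1 v.1) 0 := by
      refine Filter.Eventually.of_forall fun t => ?_
      have := hg (expMap x (t • v))
      rw [logMap_expMap, Submodule.coe_smul, mink_smul_right] at this
      simp only [zero_smul, expMap_zero, zero_mul, sub_zero]
      linarith
    have := hmin.hasDerivAt_eq_zero
      (hd.hasDerivAt.sub ((hasDerivAt_id (0 : ℝ)).mul_const (mink g.1 v.1)))
    linarith
  intro g hg k hk
  by_contra hne
  have hne' : tnorm (g - k) ≠ 0 := fun h => hne (sub_eq_zero.1 (eq_zero_of_tnorm_eq_zero h))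
  have h1 := (key _ hne' g hg).trans (key _ hne' k hk).symm
  have h2 : mink (g - k).1 (g - k).1 = 0 := by
    rw [Submodule.coe_sub] at h1 ⊢
    rw [mink_sub_left, h1, sub_self]
  exact hne' (by rw [tnorm, h2, Real.sqrt_zero])

/-! ## Smoothed maxima of distances to half-spaces -/

/-- A smoothed maximum of `0` and the shifted signed distances `arsinh ⟪n l, p⟫ - l η`, `l < k`. -/
def envelope {d : ℕ} (η : ℝ) (n : ℕ → Ambient d) : ℕ → Ambient d → ℝ
  | 0, _ => 0
  | k + 1, p => envelope η n k p
      + ramp η (Real.arsinh (mink (n k) p) - k * η - envelope η n k p)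

section Envelope

variable {d : ℕ} {η : ℝ} (n : ℕ → Ambient d)

theorem envelope_mono (p : Ambient d) : Monotone fun k => envelope η n k p :=
  monotone_nat_of_le_succ fun _ => le_add_of_nonneg_right (ramp_nonneg _)

theorem envelope_nonneg (k : ℕ) (p : Ambient d) : 0 ≤ envelope η n k p :=
  envelope_mono n p (Nat.zero_le k)

theorem arsinh_sub_le_envelope (k : ℕ) (p : Ambient d) :
    Real.arsinh (mink (n k) p) - (k + 1) * η ≤ envelope η n (k + 1) p := by
  have := sub_le_ramp (η := η) (Real.arsinh (mink (n k) p) - k * η - envelope η n k p)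
  simp only [envelope]
  linarith

theorem envelope_succ_eq (hη : 0 ≤ η) {k : ℕ} {p : Ambient d}
    (h : Real.arsinh (mink (n k) p) - k * η ≤ envelope η n k p) :
    envelope η n (k + 1) p = envelope η n k p := by
  rw [envelope, ramp_of_nonpos hη (by linarith), add_zero]

theorem envelope_eq_zero (hη : 0 ≤ η) {p : Ambient d} (k : ℕ)
    (h : ∀ l < k, mink (n l) p ≤ 0) : envelope η n k p = 0 := by
  induction k with
  | zero => rfl
  | succ k ih =>
    have hk := ih fun l hl => h l (by omega)
    rw [envelope_succ_eq n hη, hk]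
    have h1 := Real.arsinh_nonpos_iff.2 (h k (by omega))
    have h2 : 0 ≤ (k : ℝ) * η := by positivity
    rw [hk]
    linarith

/-- Later half-spaces which are at least as close to `p` as the `k`-th one do not contribute. -/
theorem envelope_eq_of_le (hη : 0 ≤ η) {p : Ambient d} {k m : ℕ} (hkm : k < m)
    (h : ∀ l, k < l → l < m → mink (n l) p ≤ mink (n k) p) :
    envelope η n m p = envelope η n (k + 1) p := by
  induction m, hkm using Nat.le_induction with
  | base => rfl
  | succ m hm ih =>
    have hm' := ih fun l h1 h2 => h l h1 (by omega)
    rw [envelope_succ_eq n hη, hm']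
    have h1 := Real.arsinh_le_arsinh.2 (h m hm (by omega))
    have h2 := arsinh_sub_le_envelope (η := η) n k p
    -- The larger shift of a later half-space pays for both the shift `k η` and the smoothing loss
    -- `η` of the `k`-th one.
    have h3 : ((k : ℝ) + 1) * η ≤ m * η :=
      mul_le_mul_of_nonneg_right (by exact_mod_cast hm) hη
    rw [hm']
    linarith

theorem differentiable_mink_right (q : Ambient d) :
    Differentiable ℝ fun p : Ambient d => mink q p := by
  exact ((differentiable_const q.2).inner ℝ differentiable_snd).sub
    (differentiable_fst.const_mul q.1)

theorem differentiable_envelope (hη : 0 < η) (k : ℕ) : Differentiable ℝ (envelope η n k) := by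
  induction k with
  | zero => exact differentiable_const 0
  | succ k ih =>
    exact ih.add ((differentiable_ramp hη).comp
      (((Real.differentiable_arsinh.comp (differentiable_mink_right (n k))).sub_const _).sub ih))

theorem hasUnitSubgradients_envelope (hη : 0 < η) (k : ℕ) (hn : ∀ l < k, mink (n l) (n l) = 1) :
    HasUnitSubgradients fun x : Space d => envelope η n k x.1 := by
  induction k with
  | zero => exact hasUnitSubgradients_zero
  | succ k ih =>
    have h1 := (ih fun l hl => hn l (by omega)).add_ramp
      ((hasUnitSubgradients_halfspace (hn k (by omega))).sub_const (k * η)) hη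
    convert h1 using 2 with x
    rw [envelope]
    congr 1
    -- The signed distance is smooth on the ambient space; its positive part is the function known
    -- to have subgradients. Both give the same ramp: at negative values both ramp arguments are
    -- nonpositive, because the envelope and the shift are nonnegative.
    rcases le_total (Real.arsinh (mink (n k) x.1)) 0 with h | h
    · have h2 := envelope_nonneg (η := η) n k x.1
      have h3 : 0 ≤ (k : ℝ) * η := by positivity
      rw [max_eq_right h, ramp_of_nonpos hη.le (by linarith), ramp_of_nonpos hη.le (by linarith)]
    · rw [max_eq_left h]

end Envelope

/-! ## An orthonormal frame of each tangent space -/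

/-- An orthonormal frame of `T_x ℍ^d`. -/
def frame {d : ℕ} (x : Space d) (i : Fin d) : Ambient d :=
  (x.1.2 i, EuclideanSpace.single i 1 + (x.1.2 i / (1 + x.1.1)) • x.1.2)

/-- The frame is the image of the standard spatial basis under the Lorentz boost carrying `(1, 0)`
to `x`. -/
theorem mink_frame_base {d : ℕ} (x : Space d) (i : Fin d) : mink (frame x i) x.1 = 0 := by
  have h := sq_time_eq x
  have h1 := one_le_time x
  have h2 : (1 + x.1.1) ≠ 0 := by linarith
  have h3 : ‖x.1.2‖ ^ 2 = x.1.1 ^ 2 - 1 := by linarith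
  simp only [mink, frame, inner_add_left, inner_smul_left, EuclideanSpace.inner_single_left,
    real_inner_self_eq_norm_sq, h3]
  simp
  field_simp
  ring

theorem mink_frame_frame {d : ℕ} (x : Space d) (i j : Fin d) :
    mink (frame x i) (frame x j) = if i = j then 1 else 0 := by
  have h := sq_time_eq x
  have h1 := one_le_time x
  have h2 : (1 + x.1.1) ≠ 0 := by linarith
  have h3 : ‖x.1.2‖ ^ 2 = x.1.1 ^ 2 - 1 := by linarith
  have h4 : (inner ℝ (EuclideanSpace.single i (1 : ℝ)) (EuclideanSpace.single j (1 : ℝ)) : ℝ)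
      = if i = j then 1 else 0 := by
    rw [EuclideanSpace.inner_single_left]
    simp
  simp only [mink, frame, inner_add_left, inner_add_right, inner_smul_left, inner_smul_right, h4,
    EuclideanSpace.inner_single_left, EuclideanSpace.inner_single_right,
    real_inner_self_eq_norm_sq, h3]
  simp
  field_simp
  ring

/-- The unit normal of the hyperplane at distance `δ` from `x` in the direction
`-s • frame x i`. -/
def normal {d : ℕ} (x : Space d) (δ : ℝ) (i : Fin d) (s : ℝ) : Ambient d :=
  (s * Real.cosh δ) • frame x i - Real.sinh δ • x.1

theorem mink_normal {d : ℕ} (x : Space d) (δ : ℝ) (i : Fin d) (s : ℝ) (p : Ambient d) :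
    mink (normal x δ i s) p
      = s * mink (frame x i) p * Real.cosh δ - Real.sinh δ * mink x.1 p := by
  rw [normal, mink_sub_left, mink_smul_left, mink_smul_left]; ring

theorem mink_normal_self {d : ℕ} (x : Space d) (δ : ℝ) (i : Fin d) {s : ℝ} (hs : s ^ 2 = 1) :
    mink (normal x δ i s) (normal x δ i s) = 1 := by
  have h1 : mink x.1 (frame x i) = 0 := by rw [mink_comm, mink_frame_base]
  rw [mink_normal, normal, mink_sub_right, mink_sub_right, mink_smul_right, mink_smul_right,
    mink_smul_right, mink_smul_right, h1, mink_frame_base, mink_frame_frame, x.2.1, if_pos rfl]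
  have := Real.cosh_sq δ
  linear_combination Real.cosh δ ^ 2 * hs + this

/-- Half-spaces at distance `δ ≤ tanh r / √T` in `T` orthogonal directions have a common point in
the ball of radius `r`. -/
theorem exists_mink_normal_nonpos {d T : ℕ} (x : Space d) {r δ : ℝ} (hr : 0 ≤ r) (hT : 0 < T)
    (hδ0 : 0 ≤ δ) (hδ : δ ≤ Real.tanh r / √(T : ℝ)) {i : ℕ → Fin d} {s : ℕ → ℝ}
    (hs : ∀ k, s k ^ 2 = 1) (hi : Set.InjOn i (Set.Iio T)) :
    ∃ p : Space d, hdist p x ≤ r ∧ ∀ k < T, mink (normal x δ (i k) (s k)) p.1 ≤ 0 := by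
  have hT' : (0 : ℝ) < T := by exact_mod_cast hT
  have hsqT : 0 < √(T : ℝ) := Real.sqrt_pos.2 hT'
  have hTT : √(T : ℝ) ^ 2 = T := Real.sq_sqrt hT'.le
  set w : Ambient d := ∑ l ∈ Finset.range T, s l • frame x (i l) with hw
  have hfw : ∀ k < T, mink (frame x (i k)) w = s k := fun k hk => by
    rw [hw, mink_sum_right, Finset.sum_eq_single_of_mem k (Finset.mem_range.2 hk)]
    · rw [mink_smul_right, mink_frame_frame, if_pos rfl, mul_one]
    · intro l hl hlk
      rw [mink_smul_right, mink_frame_frame, if_neg, mul_zero]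
      exact fun h => hlk (hi (Set.mem_Iio.2 (Finset.mem_range.1 hl)) (Set.mem_Iio.2 hk) h.symm)
  have hxw : mink x.1 w = 0 := by
    rw [hw, mink_sum_right]
    refine Finset.sum_eq_zero fun l _ => ?_
    rw [mink_smul_right, mink_comm, mink_frame_base, mul_zero]
  have hww : mink w w = T := by
    conv_lhs => rw [hw, mink_comm, mink_sum_right]
    rw [Finset.sum_congr rfl (g := fun _ => (1 : ℝ))]
    · simp
    · intro l hl
      rw [mink_smul_right, ← hw, mink_comm, hfw l (Finset.mem_range.1 hl), ← hs l, sq]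
  -- The diagonal direction, equally deep in all `T` half-spaces, scaled to length `r`.
  let v : TangentAt x := (-(r / √(T : ℝ))) • ⟨w, hxw⟩
  have hv : tnorm v = r := by
    rw [tnorm_smul, tnorm, abs_neg, abs_of_nonneg (by positivity)]
    change _ * √(mink w w) = r
    rw [hww]
    field_simp
  refine ⟨expMap x v, ?_, fun k hk => ?_⟩
  · rw [hdist_comm, hdist_expMap, hv]
  · have hv1 : v.1 = (-(r / √(T : ℝ))) • w := rfl
    rw [mink_normal, expMap_coe, hv, hv1, mink_add_right, mink_add_right]
    simp only [mink_smul_right, mink_frame_base, hfw k hk, hxw, x.2.1]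
    -- Membership in each half-space amounts to `tanh δ ≤ tanh r / √T`, which follows from `tanh δ ≤
    -- δ`.
    have h1 : Real.sinh δ * (√(T : ℝ) * Real.cosh r) ≤ Real.sinh r * Real.cosh δ := by
      have hc := Real.cosh_pos r
      rw [Real.tanh_eq_sinh_div_cosh, div_div, le_div_iff₀ (by positivity)] at hδ
      have h2 := sinh_le_mul_cosh hδ0
      have h3 : (0 : ℝ) ≤ √(T : ℝ) * Real.cosh r := by positivity
      have h4 := mul_le_mul_of_nonneg_right h2 h3
      have h5 := mul_le_mul_of_nonneg_right hδ (Real.cosh_pos δ).le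
      calc Real.sinh δ * (√(T : ℝ) * Real.cosh r)
          ≤ δ * Real.cosh δ * (√(T : ℝ) * Real.cosh r) := h4
        _ = δ * (Real.cosh r * √(T : ℝ)) * Real.cosh δ := by ring
        _ ≤ _ := h5
    have h2 : Real.sinh δ * Real.cosh r ≤ Real.sinh r * Real.cosh δ / √(T : ℝ) := by
      rw [le_div_iff₀ hsqT]; linarith
    have h3 : Real.sinh r / r * (r / √(T : ℝ)) = Real.sinh r / √(T : ℝ) := by
      rcases eq_or_ne r 0 with rfl | h
      · simp
      · field_simp
    have h4 : s k * (Real.cosh r * 0 + Real.sinh r / r * (-(r / √(T : ℝ)) * s k)) * Real.cosh δ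
        = -(Real.sinh r * Real.cosh δ / √(T : ℝ)) := by
      linear_combination (-(Real.sinh r / r * (r / √(T : ℝ))) * Real.cosh δ) * hs k
        - Real.cosh δ * h3
    rw [h4]
    linarith

/-! ## The resisting oracle -/

/-- The data of a resisting oracle after `k` queries: the answers given, the directions used, and
the function committed to. -/
structure Resistance (d k : ℕ) where
  hist : Fin k → Answer d
  used : Finset (Fin d)
  fn : Ambient d → ℝ

/-- An unused direction in which `x` is farthest from `xref`. -/
def farthestDirection {d : ℕ} [NeZero d] (xref : Space d) (S : Finset (Fin d)) (x : Space d) :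
    Fin d :=
  Classical.epsilon fun i => i ∉ S ∧
    ∀ j ∉ S, |mink (frame xref j) x.1| ≤ |mink (frame xref i) x.1|

theorem farthestDirection_spec {d : ℕ} [NeZero d] (xref : Space d) {S : Finset (Fin d)}
    (hS : S.card < d) (x : Space d) : farthestDirection xref S x ∉ S ∧
      ∀ j ∉ S, |mink (frame xref j) x.1| ≤ |mink (frame xref (farthestDirection xref S x)) x.1| := by
  refine Classical.epsilon_spec (p := fun i => i ∉ S ∧
    ∀ j ∉ S, |mink (frame xref j) x.1| ≤ |mink (frame xref i) x.1|) ?_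
  have hne : Sᶜ.Nonempty := by
    rw [← Finset.card_pos, Finset.card_compl, Fintype.card_fin]
    omega
  obtain ⟨i, hi, h⟩ := Finset.exists_max_image Sᶜ (fun i => |mink (frame xref i) x.1|) hne
  exact ⟨i, Finset.mem_compl.1 hi, fun j hj => h j (Finset.mem_compl.2 hj)⟩

/-- The sign of a real number, with value `1` at zero. -/
def signOf (t : ℝ) : ℝ := if 0 ≤ t then 1 else -1

theorem signOf_sq (t : ℝ) : signOf t ^ 2 = 1 := by
  unfold signOf; split_ifs <;> norm_num

theorem signOf_mul_self (t : ℝ) : signOf t * t = |t| := by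
  unfold signOf
  split_ifs with h
  · rw [abs_of_nonneg h, one_mul]
  · rw [abs_of_neg (not_le.1 h)]; ring

theorem mul_le_abs_of_sq_eq_one {s : ℝ} (hs : s ^ 2 = 1) (t : ℝ) : s * t ≤ |t| := by
  refine (le_abs_self _).trans_eq ?_
  rw [abs_mul, ← Real.sqrt_sq_eq_abs s, hs, Real.sqrt_one, one_mul]

section Resisting

variable {d : ℕ} [NeZero d] (xref : Space d) (M δ η : ℝ) (A : Algorithm d)

/-- The resisting oracle: at each query, commit to a new half-space as far as possible from the
query, and answer with the current function. -/
def resistance : (k : ℕ) → Resistance d k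
  | 0 => ⟨Fin.elim0, ∅, fun _ => 0⟩
  | k + 1 =>
    let R := resistance k
    let x := A k R.hist
    let i := farthestDirection xref R.used x
    let n := normal xref δ i (signOf (mink (frame xref i) x.1))
    let F := fun p => R.fn p + ramp η (Real.arsinh (mink n p) - k * η - R.fn p)
    ⟨Fin.snoc (α := fun _ => Answer d) R.hist (M * F x.1,
      ⟨x, Classical.epsilon fun g => g ∈ subdifferential (fun y => M * F y.1) x⟩),
      insert i R.used, F⟩

/-- The `k`-th query of the resisted run. -/
def resistedQuery (k : ℕ) : Space d := A k (resistance xref M δ η A k).hist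

/-- The direction committed to after the `k`-th query. -/
def resistedDirection (k : ℕ) : Fin d :=
  farthestDirection xref (resistance xref M δ η A k).used (resistedQuery xref M δ η A k)

/-- The sign of the `k`-th query in the direction committed to after it. -/
def resistedSign (k : ℕ) : ℝ :=
  signOf (mink (frame xref (resistedDirection xref M δ η A k)) (resistedQuery xref M δ η A k).1)

/-- The normal of the half-space committed to after the `k`-th query. -/
def resistedNormal (k : ℕ) : Ambient d :=
  normal xref δ (resistedDirection xref M δ η A k) (resistedSign xref M δ η A k)

theorem resistance_fn (k : ℕ) :
    (resistance xref M δ η A k).fn = envelope η (resistedNormal xref M δ η A) k := by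
  induction k with
  | zero => rfl
  | succ k ih =>
    funext p
    rw [envelope, ← ih]
    rfl

theorem resistance_used (k : ℕ) : (resistance xref M δ η A k).used
    = (Finset.range k).image (resistedDirection xref M δ η A) := by
  induction k with
  | zero => rfl
  | succ k ih =>
    rw [Finset.range_add_one, Finset.image_insert, ← ih]
    rfl

theorem resistance_hist_succ (k : ℕ) : (resistance xref M δ η A (k + 1)).hist
    = Fin.snoc (α := fun _ => Answer d) (resistance xref M δ η A k).hist
      (M * envelope η (resistedNormal xref M δ η A) (k + 1) (resistedQuery xref M δ η A k).1,
        ⟨resistedQuery xref M δ η A k, Classical.epsilon fun g => g ∈ subdifferential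
          (fun y => M * envelope η (resistedNormal xref M δ η A) (k + 1) y.1)
          (resistedQuery xref M δ η A k)⟩) := by
  rw [← resistance_fn]
  rfl

theorem card_resistance_used_le (k : ℕ) : (resistance xref M δ η A k).used.card ≤ k := by
  rw [resistance_used]
  exact Finset.card_image_le.trans_eq (Finset.card_range k)

theorem resistedDirection_ne {k l : ℕ} (hkl : k < l) (hl : l < d) :
    resistedDirection xref M δ η A l ≠ resistedDirection xref M δ η A k := by
  have h := (farthestDirection_spec xref ((card_resistance_used_le xref M δ η A l).trans_lt hl)
    (resistedQuery xref M δ η A l)).1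
  change resistedDirection xref M δ η A l ∉ _ at h
  rw [resistance_used] at h
  exact fun he => h (Finset.mem_image.2 ⟨k, Finset.mem_range.2 hkl, he.symm⟩)

theorem injOn_resistedDirection :
    Set.InjOn (resistedDirection xref M δ η A) (Set.Iio d) := by
  intro k hk l hl h
  rcases lt_trichotomy k l with hlt | he | hlt
  · exact absurd h.symm (resistedDirection_ne xref M δ η A hlt hl)
  · exact he
  · exact absurd h (resistedDirection_ne xref M δ η A hlt hk)

theorem abs_mink_frame_resisted_le {k l : ℕ} (hkl : k < l) (hl : l < d) :
    |mink (frame xref (resistedDirection xref M δ η A l)) (resistedQuery xref M δ η A k).1|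
      ≤ |mink (frame xref (resistedDirection xref M δ η A k))
          (resistedQuery xref M δ η A k).1| := by
  refine (farthestDirection_spec xref
    ((card_resistance_used_le xref M δ η A k).trans_lt (hkl.trans hl))
    (resistedQuery xref M δ η A k)).2 _ ?_
  rw [resistance_used, Finset.mem_image]
  rintro ⟨m, hm, he⟩
  exact resistedDirection_ne xref M δ η A ((Finset.mem_range.1 hm).trans hkl) hl he.symm

theorem mink_resistedNormal_query (k : ℕ) :
    mink (resistedNormal xref M δ η A k) (resistedQuery xref M δ η A k).1
      = |mink (frame xref (resistedDirection xref M δ η A k)) (resistedQuery xref M δ η A k).1|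
        * Real.cosh δ - Real.sinh δ * mink xref.1 (resistedQuery xref M δ η A k).1 := by
  rw [resistedNormal, mink_normal, resistedSign, signOf_mul_self]

/-- The normals differ only in their frame components. Direction `l` was still unused at step `k`,
so the greedy choice, with its matching sign, dominates it at the `k`-th query. -/
theorem mink_resistedNormal_le {k l : ℕ} (hkl : k < l) (hl : l < d) :
    mink (resistedNormal xref M δ η A l) (resistedQuery xref M δ η A k).1
      ≤ mink (resistedNormal xref M δ η A k) (resistedQuery xref M δ η A k).1 := by
  rw [mink_resistedNormal_query, resistedNormal, mink_normal]
  refine sub_le_sub_right (mul_le_mul_of_nonneg_right ?_ (Real.cosh_pos δ).le) _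
  exact (mul_le_abs_of_sq_eq_one (signOf_sq _) _).trans
    (abs_mink_frame_resisted_le xref M δ η A hkl hl)

/-- The matching sign makes the frame term nonnegative, and `-⟪xref, x⟫ ≥ 1` leaves at least `sinh
δ`. -/
theorem le_arsinh_resistedNormal_query (hδ : 0 ≤ δ) (k : ℕ) :
    δ ≤ Real.arsinh
      (mink (resistedNormal xref M δ η A k) (resistedQuery xref M δ η A k).1) := by
  rw [← Real.sinh_le_sinh, Real.sinh_arsinh, mink_resistedNormal_query]
  have h1 := one_le_neg_mink xref (resistedQuery xref M δ η A k)
  have h2 : 0 ≤ Real.sinh δ := Real.sinh_nonneg_iff.2 hδ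
  have h3 := mul_nonneg (abs_nonneg (mink (frame xref (resistedDirection xref M δ η A k))
    (resistedQuery xref M δ η A k).1)) (Real.cosh_pos δ).le
  nlinarith

/-- A run with an arbitrary oracle for the final function reproduces the resisted run. -/
theorem history_eq_resistance {η : ℝ} (hη : 0 < η) {M : ℝ} (hM : 0 < M) {T : ℕ} (hT : T ≤ d)
    (O : Oracle fun x : Space d => M * envelope η (resistedNormal xref M δ η A) T x.1)
    (k : ℕ) (hk : k ≤ T) : history A O k = (resistance xref M δ η A k).hist := by
  induction k with
  | zero => rfl
  | succ k ih =>
    rw [history, ih (by omega), resistance_hist_succ]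
    change Fin.snoc (α := fun _ => Answer d) _ (O.answer (resistedQuery xref M δ η A k)) = _
    congr 1
    have heq : envelope η (resistedNormal xref M δ η A) T (resistedQuery xref M δ η A k).1
        = envelope η (resistedNormal xref M δ η A) (k + 1) (resistedQuery xref M δ η A k).1 :=
      envelope_eq_of_le _ hη.le hk fun l h1 h2 =>
        mink_resistedNormal_le xref M δ η A h1 (by omega)
    have hmem := Classical.epsilon_spec
      ((hasUnitSubgradients_envelope (resistedNormal xref M δ η A) hη (k + 1) fun l _ =>
        mink_normal_self _ _ _ (signOf_sq _)).subdifferential_mul_nonempty hM.le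
        (resistedQuery xref M δ η A k))
    rw [Oracle.answer, heq]
    refine congrArg (fun g : TangentAt (resistedQuery xref M δ η A k) =>
      ((_, ⟨_, g⟩) : Answer d)) ?_
    -- The committed function lies below the final one and agrees with it at the query, so the
    -- answered subgradient is also one for the final function; uniqueness identifies it with the
    -- oracle's answer.
    refine subdifferential_subsingleton
      ((differentiable_envelope (resistedNormal xref M δ η A) hη T).const_mul M)
      (resistedQuery xref M δ η A k) (O.subgrad_mem _) fun y => ?_
    refine le_trans ?_ ((hmem y).trans
      (mul_le_mul_of_nonneg_left (envelope_mono (resistedNormal xref M δ η A) y.1 hk) hM.le))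
    exact (congrArg (fun c => M * c + _) heq).le

end Resisting

end Hyp

end

/-! ### Choice of parameters and conclusion. -/

theorem theorem2 (r M : ℝ) (hr : 0 < r) (hM : 0 < M) (T d : ℕ) (hT : 0 < T) (hd : T ≤ d)
    (xref : Hyp.Space d) (A : Hyp.Algorithm d) :
    ∃ f ∈ Hyp.lipschitzClass xref r M,
      Nonempty (Hyp.Oracle f) ∧
      ∀ O : Hyp.Oracle f,
        (T : ℕ∞) ≤ Hyp.queryComplexity A O (M * r * (1 / (2 * Hyp.zeta r * √(T : ℝ)))) := by
  have : NeZero d := ⟨by omega⟩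
  have hT' : (0 : ℝ) < T := by exact_mod_cast hT
  have hsqT : 0 < √(T : ℝ) := Real.sqrt_pos.2 hT'
  have htanh : 0 < Real.tanh r := by
    rw [Real.tanh_eq_sinh_div_cosh]
    exact div_pos (Real.sinh_pos_iff.2 hr) (Real.cosh_pos r)
  set δ := Real.tanh r / √(T : ℝ) with hδ
  have hδ0 : 0 < δ := div_pos htanh hsqT
  -- Over `T` steps, shifts and smoothing cost at most `T η = δ / 4`, so each of the first `T`
  -- queries keeps value at least `3 M δ / 4`, strictly above `M δ / 2`.
  set η := δ / (4 * T) with hη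
  have hη0 : 0 < η := by positivity
  set n := Hyp.resistedNormal xref M δ η A with hn
  have hunit : Hyp.HasUnitSubgradients fun x : Hyp.Space d => Hyp.envelope η n T x.1 :=
    Hyp.hasUnitSubgradients_envelope n hη0 T fun l _ =>
      Hyp.mink_normal_self _ _ _ (Hyp.signOf_sq _)
  have hsub := hunit.subdifferential_mul_nonempty hM.le
  obtain ⟨p, hpr, hp⟩ := Hyp.exists_mink_normal_nonpos xref hr.le hT hδ0.le le_rfl
    (i := Hyp.resistedDirection xref M δ η A) (s := Hyp.resistedSign xref M δ η A)
    (fun _ => Hyp.signOf_sq _)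
    ((Hyp.injOn_resistedDirection xref M δ η A).mono (Set.Iio_subset_Iio hd))
  have hp0 : Hyp.envelope η n T p.1 = 0 := Hyp.envelope_eq_zero n hη0.le T hp
  have hnonneg : ∀ y : Hyp.Space d, 0 ≤ M * Hyp.envelope η n T y.1 := fun y =>
    mul_nonneg hM.le (Hyp.envelope_nonneg n T y.1)
  refine ⟨fun x => M * Hyp.envelope η n T x.1, ⟨hunit.isLipschitz_mul hM.le,
    Hyp.gconvex_of_subdifferential_nonempty hsub, p, hpr, fun y => ?_⟩,
    ⟨⟨fun x => (hsub x).some, fun x => (hsub x).some_mem⟩⟩, fun O => ?_⟩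
  · exact (mul_eq_zero_of_right M hp0).trans_le (hnonneg y)
  · refine le_iInf₂ fun k hk => ?_
    by_contra hlt
    have hkT : k < T := by exact_mod_cast not_le.1 hlt
    have hq : Hyp.query A O k = Hyp.resistedQuery xref M δ η A k := by
      rw [Hyp.query, Hyp.history_eq_resistance xref δ A hη0 hM hd O k hkT.le]
      rfl
    have hinf : (⨅ y : Hyp.Space d, M * Hyp.envelope η n T y.1) ≤ 0 := by
      refine (ciInf_le ⟨0, ?_⟩ p).trans_eq (by rw [hp0, mul_zero])
      rintro _ ⟨y, rfl⟩
      exact hnonneg y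
    rw [hq] at hk
    have h1 := Hyp.le_arsinh_resistedNormal_query xref M δ η A hδ0.le k
    have h2 := Hyp.arsinh_sub_le_envelope (η := η) n k (Hyp.resistedQuery xref M δ η A k).1
    have h3 : Hyp.envelope η n (k + 1) (Hyp.resistedQuery xref M δ η A k).1
        ≤ Hyp.envelope η n T (Hyp.resistedQuery xref M δ η A k).1 :=
      Hyp.envelope_mono n _ hkT
    have h4 : ((k : ℝ) + 1) * η ≤ δ / 4 := by
      calc ((k : ℝ) + 1) * η ≤ T * η :=
            mul_le_mul_of_nonneg_right (by exact_mod_cast hkT) hη0.le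
        _ = δ / 4 := by rw [hη]; field_simp
    have h5 : M * r * (1 / (2 * Hyp.zeta r * √(T : ℝ))) = M * (δ / 2) := by
      rw [hδ, Hyp.zeta]; field_simp
    rw [h5] at hk
    have h6 : δ / 2 < Hyp.envelope η n T (Hyp.resistedQuery xref M δ η A k).1 := by linarith
    have h7 := mul_lt_mul_of_pos_left h6 hM
    linarith
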